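/- Let $n_1\ge 4$ be even and $n=3n_1+4$. Let $S_1,S_2,S_3$ be disjoint sets with $|S_1|=n_1$ and $|S_2|=|S_3|=n_1+2$, and let $H=\frac{n_1}{2}K_2\vee\frac{n_1+2}{2}K_2\vee\frac{n_1+2}{2}K_2$ be the graph on $S_1\cup S_2\cup S_3$ that consists of all edges between different sets $S_i$ together with a perfect matching inside each $S_i$. Let $C$ be any cycle through all vertices of $S_2\cup S_3$ that alternates between $S_2$ and $S_3$, that is, $C=x_1y_1x_2y_2\cdots x_{n_1+2}y_{n_1+2}x_1$ with $S_2=\{x_1,\dots,x_{n_1+2}\}$ and $S_3=\{y_1,\dots,y_{n_1+2}\}$. Let $G$ be the graph on $n$ vertices obtained from $H$ by deleting the edges of the matching inside $S_1$ and the edges of $C$, and let $m$ be the number of edges of $G$. Write $q_n(G)$ for the smallest eigenvalue of the signless Laplacian matrix $Q(G)=D(G)+A(G)$ (where $D(G)$ is the diagonal matrix of degrees and $A(G)$ the adjacency matrix), and $\mathrm{mc}_3(G)$ for the maximum number of edges in a $3$-partite subgraph of $G$. Then $$q_n(G)=n_1+2\qquad\text{and}\qquad \mathrm{mc}_3(G)=\frac{3-1}{3}\left(2m-\frac{n\,q_n(G)}{2}\right).$$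 -/

import Mathlib

/-- The signless Laplacian matrix `Q(G) = D(G) + A(G)`. -/
noncomputable def signlessLaplacian {V : Type*} [Fintype V] [DecidableEq V]
    (G : SimpleGraph V) [DecidableRel G.Adj] : Matrix V V ℝ :=
  G.degMatrix ℝ + G.adjMatrix ℝ

theorem signlessLaplacian_isHermitian {V : Type*} [Fintype V] [DecidableEq V]
    (G : SimpleGraph V) [DecidableRel G.Adj] : (signlessLaplacian G).IsHermitian :=
  (G.isHermitian_degMatrix ℝ).add (G.isHermitian_adjMatrix ℝ)

open Classical in
/-- The eigenvalues of `Q(G)`, with multiplicity, in non-increasing order; the index `i` (counted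
from `0`) gives the `(i + 1)`-th largest one. -/
noncomputable def qEigenvalue {V : Type*} [Fintype V] (G : SimpleGraph V)
    (i : Fin (Fintype.card V)) : ℝ :=
  (signlessLaplacian_isHermitian G).eigenvalues₀ i

/-- `qₙ(G)` with `n = |V|`: the last, hence smallest, eigenvalue of `Q(G)`. -/
noncomputable def smallestQEigenvalue {V : Type*} [Fintype V] [Nonempty V]
    (G : SimpleGraph V) : ℝ :=
  qEigenvalue G ⟨Fintype.card V - 1, Nat.sub_lt Fintype.card_pos Nat.one_pos⟩

/-- `mc_k(G)`: the maximum number of edges in a `k`-partite subgraph of `G`. Adding isolated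
vertices to a subgraph changes nothing, so spanning subgraphs suffice. -/
noncomputable def maxKCut {V : Type*} [Finite V] (k : ℕ) (G : SimpleGraph V) : ℕ :=
  sSup {c : ℕ | ∃ B : SimpleGraph V, B ≤ G ∧ B.Colorable k ∧ B.edgeSet.ncard = c}

/-- The join of two graphs: their disjoint union together with all edges between them. -/
def graphJoin {V W : Type*} (G : SimpleGraph V) (H : SimpleGraph W) : SimpleGraph (V ⊕ W) :=
  (G ⊕g H) ⊔ completeBipartiteGraph V W

/-- The graph on `N` vertices with edges `{0, 1}, {2, 3}, …`. For even `N` this is `(N/2) K₂`. -/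
def pairGraph (N : ℕ) : SimpleGraph (Fin N) where
  Adj i j := i ≠ j ∧ i.val / 2 = j.val / 2
  symm := ⟨fun _ _ h => ⟨h.1.symm, h.2.symm⟩⟩
  loopless := ⟨fun _ h => h.1 rfl⟩

/-- The vertex set `S₁ ∪ S₂ ∪ S₃`, with `|S₁| = n₁` and `|S₂| = |S₃| = n₁ + 2`. -/
abbrev TripartiteVertex (n₁ : ℕ) : Type := Fin n₁ ⊕ (Fin (n₁ + 2) ⊕ Fin (n₁ + 2))

/-- `H = (n₁/2) K₂ ∨ ((n₁+2)/2) K₂ ∨ ((n₁+2)/2) K₂`. -/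
def graphH (n₁ : ℕ) : SimpleGraph (TripartiteVertex n₁) :=
  graphJoin (pairGraph n₁) (graphJoin (pairGraph (n₁ + 2)) (pairGraph (n₁ + 2)))

/-- The cycle `x₀ y₀ x₁ y₁ ⋯ x_{n₁+1} y_{n₁+1} x₀` through all of `S₂ ∪ S₃`, where `xᵢ` is the
vertex `σ i` of `S₂` and `yᵢ` is the vertex `τ i` of `S₃`; here `i + 1` is taken modulo `n₁ + 2`.
For `σ = τ = 1` it follows the given labelling of `S₂` and `S₃`, and every Hamiltonian cycle
alternating between `S₂` and `S₃` has this form. -/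
def alternatingCycle (n₁ : ℕ) (σ τ : Equiv.Perm (Fin (n₁ + 2))) :
    SimpleGraph (TripartiteVertex n₁) :=
  SimpleGraph.fromEdgeSet
    ({e | ∃ i, e = s(Sum.inr (Sum.inl (σ i)), Sum.inr (Sum.inr (τ i)))} ∪
      {e | ∃ i, e = s(Sum.inr (Sum.inr (τ i)), Sum.inr (Sum.inl (σ (i + 1))))})

/-- `F`, whose edges are the perfect matching of `H[S₁]` and the alternating Hamiltonian cycle. -/
def graphF (n₁ : ℕ) (σ τ : Equiv.Perm (Fin (n₁ + 2))) : SimpleGraph (TripartiteVertex n₁) :=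
  (pairGraph n₁).map Function.Embedding.inl ⊔ alternatingCycle n₁ σ τ

/-- `G`, with `V(G) = V(H)` and `E(G) = E(H) \ E(F)`. -/
def extremalGraph (n₁ : ℕ) (σ τ : Equiv.Perm (Fin (n₁ + 2))) :
    SimpleGraph (TripartiteVertex n₁) :=
  graphH n₁ \ graphF n₁ σ τ

/-! Twice the form of Q(G) is the sum of (x_u + x_v)² over ordered adjacent pairs, so a bound q ≤
qₙ(G) can be tested on vectors built from a k-colouring. Summing over the k centred colour
indicators gives |E(B)| ≤ ((k-1)/k)(2m - nq/2) for each k-partite B ≤ G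
(`ncard_edgeSet_le_of_colorable`).

For the present G the form is at least 2(n₁+2)‖x‖² (`adjSum_extremalGraph_ge`): Cauchy–Schwarz on
the parts, the matchings and the cycle reduces this to the squared-sum inequality ((n₁+2)A +
n₁(B+C))² ≥ 0 in the sums A, B, C of x over S₁, S₂, S₃. The vector (0, 1, -1) attains equality, so
qₙ(G) = n₁+2. The cut into S₁, S₂, S₃ has 3n₁(n₁+2) edges, exactly the upper bound. -/

/-- The sum of `f` over all ordered pairs of adjacent vertices. -/
noncomputable def adjSum {V : Type*} [Fintype V] (G : SimpleGraph V) (f : V → V → ℝ) : ℝ :=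
  open Classical in ∑ u, ∑ v, if G.Adj u v then f u v else 0

theorem adjSum_mono {V : Type*} [Fintype V] {G G' : SimpleGraph V} {f g : V → V → ℝ}
    (h : G ≤ G') (hfg : ∀ u v, G.Adj u v → f u v ≤ g u v) (hg : ∀ u v, 0 ≤ g u v) :
    adjSum G f ≤ adjSum G' g := by
  classical
  refine Finset.sum_le_sum fun u _ => Finset.sum_le_sum fun v _ => ?_
  by_cases huv : G.Adj u v
  · simpa [huv, h huv] using hfg u v huv
  · simp only [huv, if_false]
    split_ifs
    exacts [hg u v, le_rfl]

theorem adjSum_one {V : Type*} [Fintype V] (G : SimpleGraph V) :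
    adjSum G (fun _ _ => 1) = 2 * (G.edgeSet.ncard : ℝ) := by
  classical
  have h := G.sum_degrees_eq_twice_card_edges
  rw [← SimpleGraph.coe_edgeFinset, Set.ncard_coe_finset]
  rw [adjSum]
  have h' : (∑ v, (G.degree v : ℝ)) = 2 * (G.edgeFinset.card : ℝ) := by exact_mod_cast h
  rw [← h']
  refine Finset.sum_congr rfl fun u _ => ?_
  rw [Finset.sum_boole, ← SimpleGraph.card_neighborFinset_eq_degree,
    SimpleGraph.neighborFinset_eq_filter]

/-! ### The signless Laplacian form and its smallest eigenvalue. -/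

theorem signlessLaplacian_mulVec_apply {V : Type*} [Fintype V] [DecidableEq V]
    (G : SimpleGraph V) [DecidableRel G.Adj] (x : V → ℝ) (u : V) :
    (signlessLaplacian G).mulVec x u = ∑ v, if G.Adj u v then x u + x v else 0 := by
  rw [signlessLaplacian, Matrix.add_mulVec, Pi.add_apply, SimpleGraph.adjMatrix_mulVec_apply,
    SimpleGraph.degMatrix, Matrix.mulVec_diagonal, SimpleGraph.neighborFinset_eq_filter,
    Finset.sum_filter, ← SimpleGraph.card_neighborFinset_eq_degree,
    SimpleGraph.neighborFinset_eq_filter, ← Finset.sum_boole, Finset.sum_mul,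
    ← Finset.sum_add_distrib]
  refine Finset.sum_congr rfl fun v _ => ?_
  split_ifs <;> simp

theorem two_mul_dotProduct_signlessLaplacian {V : Type*} [Fintype V] [DecidableEq V]
    (G : SimpleGraph V) [DecidableRel G.Adj] (x : V → ℝ) :
    2 * (x ⬝ᵥ (signlessLaplacian G).mulVec x) = adjSum G fun u v => (x u + x v) ^ 2 := by
  classical
  have h : x ⬝ᵥ (signlessLaplacian G).mulVec x =
      ∑ u, ∑ v, if G.Adj u v then x u * (x u + x v) else 0 := by
    simp only [dotProduct, signlessLaplacian_mulVec_apply, Finset.mul_sum, mul_ite, mul_zero]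
  have h' : x ⬝ᵥ (signlessLaplacian G).mulVec x =
      ∑ u, ∑ v, if G.Adj u v then x v * (x u + x v) else 0 := by
    rw [h, Finset.sum_comm]
    simp only [G.adj_comm, add_comm]
  rw [two_mul]
  nth_rewrite 1 [h]
  rw [h', adjSum, ← Finset.sum_add_distrib]
  refine Finset.sum_congr rfl fun u _ => ?_
  rw [← Finset.sum_add_distrib]
  refine Finset.sum_congr rfl fun v _ => ?_
  split_ifs
  · ring
  · simp

/-- `Q - μ • 1` is positive semidefinite, so a vector at which its form vanishes lies in its kernel;
hence μ is an eigenvalue, and none is smaller. -/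
theorem smallestQEigenvalue_eq {V : Type*} [Fintype V] [Nonempty V] (G : SimpleGraph V) (μ : ℝ)
    (hμ : ∀ x : V → ℝ, 2 * μ * ∑ v, x v ^ 2 ≤ adjSum G fun u v => (x u + x v) ^ 2)
    (x : V → ℝ) (hx : x ≠ 0)
    (hxμ : 2 * μ * ∑ v, x v ^ 2 = adjSum G fun u v => (x u + x v) ^ 2) :
    smallestQEigenvalue G = μ := by
  classical
  set Q := signlessLaplacian G with hQ
  have hH : Q.IsHermitian := signlessLaplacian_isHermitian G
  have hform : ∀ y : V → ℝ, y ⬝ᵥ (Q - μ • (1 : Matrix V V ℝ)).mulVec y =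
      (adjSum G (fun u v => (y u + y v) ^ 2) - 2 * μ * ∑ v, y v ^ 2) / 2 := by
    intro y
    rw [← two_mul_dotProduct_signlessLaplacian, Matrix.sub_mulVec, dotProduct_sub,
      Matrix.smul_mulVec, Matrix.one_mulVec, dotProduct_smul, smul_eq_mul]
    simp only [dotProduct, ← pow_two]
    ring
  have hps : (Q - μ • (1 : Matrix V V ℝ)).PosSemidef := by
    refine Matrix.PosSemidef.of_dotProduct_mulVec_nonneg ?_ fun y => ?_
    · refine hH.sub ?_
      simp [Matrix.IsHermitian]
    · rw [star_trivial, hform]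
      linarith [hμ y]
  have hker : Q.mulVec x = μ • x := by
    have h0 := (hps.dotProduct_mulVec_zero_iff x).1 (by
      rw [star_trivial, hform, hxμ]; simp)
    rw [Matrix.sub_mulVec, Matrix.smul_mulVec, Matrix.one_mulVec] at h0
    exact sub_eq_zero.1 h0
  have hmem : μ ∈ spectrum ℝ Q := by
    rw [← Matrix.spectrum_toLin']
    refine Module.End.HasEigenvalue.mem_spectrum ?_
    refine Module.End.hasEigenvalue_of_hasEigenvector (x := x) ⟨?_, hx⟩
    rw [Module.End.mem_eigenspace_iff, Matrix.toLin'_apply, hker]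
  rw [hH.spectrum_real_eq_range_eigenvalues] at hmem
  obtain ⟨i, hi⟩ := hmem
  set last : Fin (Fintype.card V) :=
    ⟨Fintype.card V - 1, Nat.sub_lt Fintype.card_pos Nat.one_pos⟩ with hlast
  have hval : smallestQEigenvalue G = hH.eigenvalues₀ last := by
    unfold smallestQEigenvalue qEigenvalue
    congr!
  rw [hval]
  apply le_antisymm
  · rw [← hi]
    refine hH.eigenvalues₀_antitone ?_
    rw [Fin.le_def]
    exact Nat.le_sub_one_of_lt (Fin.is_lt _)
  -- The eigenvector basis is indexed by `V`, so the last eigenvalue is first carried over to an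
  -- index in `V`.
  · obtain ⟨j, hj⟩ : ∃ j, hH.eigenvalues j = hH.eigenvalues₀ last :=
      ⟨Fintype.equivOfCardEq (Fintype.card_fin _) last, by
        simp [Matrix.IsHermitian.eigenvalues]⟩
    rw [← hj]
    have hmv := hH.mulVec_eigenvectorBasis j
    set w : V → ℝ := (hH.eigenvectorBasis j).ofLp with hw
    have hw0 : w ≠ 0 := by
      intro h
      have := hH.eigenvectorBasis.orthonormal.ne_zero j
      exact this (by ext v; exact congrFun h v)
    have h2 := two_mul_dotProduct_signlessLaplacian G w
    rw [← hQ, hmv, dotProduct_smul, smul_eq_mul] at h2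
    have h3 := hμ w
    have h4 : w ⬝ᵥ w = ∑ v, w v ^ 2 := by simp only [dotProduct, ← pow_two]
    have h5 : 0 < ∑ v, w v ^ 2 := by
      rw [← h4]
      exact lt_of_le_of_ne (by rw [h4]; positivity)
        fun h => hw0 (dotProduct_self_eq_zero.1 h.symm)
    rw [← h2, h4] at h3
    exact le_of_mul_le_mul_right (by linarith) h5

/-- A lower bound on the signless Laplacian form bounds the size of every `k`-partite subgraph. -/
theorem ncard_edgeSet_le_of_colorable {V : Type*} [Fintype V] (G : SimpleGraph V) (μ : ℝ)
    (hμ : ∀ x : V → ℝ, 2 * μ * ∑ v, x v ^ 2 ≤ adjSum G fun u v => (x u + x v) ^ 2)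
    (k : ℕ) (hk : 0 < k) (B : SimpleGraph V) (hB : B ≤ G) (hc : B.Colorable k) :
    (B.edgeSet.ncard : ℝ) ≤
      (((k : ℝ) - 1) / k) * (2 * (G.edgeSet.ncard : ℝ) - Fintype.card V * μ / 2) := by
  classical
  obtain ⟨c⟩ := hc
  have hk0 : (k : ℝ) ≠ 0 := by positivity
  -- For fixed v the numbers `y t v` are the coordinates of a vertex of a regular simplex centred at
  -- the origin: inner products are 1 - 1/k within a colour and -1/k between colours.
  let y : Fin k → V → ℝ := fun t v => (if c v = t then 1 else 0) - 1 / k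
  have hsq : ∀ v, ∑ t, y t v ^ 2 = 1 - 1 / k := by
    intro v
    simp only [y, sub_sq, ite_pow, one_pow, Finset.sum_add_distrib, Finset.sum_sub_distrib]
    simp
    field_simp
    ring
  have hcr : ∀ u v, ∑ t, y t u * y t v = (if c u = c v then 1 else 0) - 1 / k := by
    intro u v
    simp only [y, sub_mul, mul_sub, Finset.sum_sub_distrib, ite_mul, mul_ite, one_mul, zero_mul,
      mul_one, mul_zero]
    simp [eq_comm]
    field_simp
    ring
  have hpair : ∀ u v, ∑ t, (y t u + y t v) ^ 2 =
      4 * (1 - 1 / (k : ℝ)) - 2 * (if c u = c v then 0 else 1) := by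
    intro u v
    have : ∑ t, (y t u + y t v) ^ 2 =
        ∑ t, y t u ^ 2 + 2 * ∑ t, y t u * y t v + ∑ t, y t v ^ 2 := by
      rw [Finset.mul_sum, ← Finset.sum_add_distrib, ← Finset.sum_add_distrib]
      exact Finset.sum_congr rfl fun t _ => by ring
    rw [this, hsq, hsq, hcr]
    split_ifs <;> ring
  have h1 : ∑ t, (2 * μ * ∑ v, y t v ^ 2) = 2 * μ * (Fintype.card V * (1 - 1 / k)) := by
    rw [← Finset.mul_sum, Finset.sum_comm]
    simp only [hsq]
    rw [Finset.sum_const, Finset.card_univ, nsmul_eq_mul]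
  have h2 : ∑ t, adjSum G (fun u v => (y t u + y t v) ^ 2) =
      4 * (1 - 1 / (k : ℝ)) * adjSum G (fun _ _ => 1) -
        2 * adjSum G (fun u v => if c u = c v then 0 else 1) := by
    simp only [adjSum]
    rw [Finset.sum_comm, Finset.mul_sum, Finset.mul_sum, ← Finset.sum_sub_distrib]
    refine Finset.sum_congr rfl fun u _ => ?_
    rw [Finset.sum_comm, Finset.mul_sum, Finset.mul_sum, ← Finset.sum_sub_distrib]
    refine Finset.sum_congr rfl fun v _ => ?_
    by_cases huv : G.Adj u v
    · simp only [huv, if_true, hpair, mul_one]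
    · simp [huv]
  have h3 := Finset.sum_le_sum fun t (_ : t ∈ Finset.univ) => hμ (y t)
  rw [h1, h2, adjSum_one] at h3
  have h4 : adjSum B (fun _ _ => 1) ≤ adjSum G (fun u v => if c u = c v then 0 else 1) :=
    adjSum_mono hB (fun u v huv => by simp [c.valid huv]) fun u v => by split_ifs <;> simp
  rw [adjSum_one] at h4
  have h5 : ((k : ℝ) - 1) / k = 1 - 1 / k := by field_simp
  rw [h5]
  linarith

/-! ### Adjacency in G, block by block. -/

/-- The neighbour of `i` in `pairGraph N`, for even `N`. -/
def pairMate {N : ℕ} (hN : Even N) (i : Fin N) : Fin N :=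
  ⟨if i.val % 2 = 0 then i.val + 1 else i.val - 1, by
    obtain ⟨k, hk⟩ := hN
    have := i.isLt
    split_ifs <;> omega⟩

theorem pairMate_pairMate {N : ℕ} (hN : Even N) (i : Fin N) :
    pairMate hN (pairMate hN i) = i := by
  ext
  simp only [pairMate]
  split_ifs <;> omega

theorem pairGraph_adj_iff {N : ℕ} (hN : Even N) (i j : Fin N) :
    (pairGraph N).Adj i j ↔ pairMate hN i = j := by
  simp only [pairGraph, pairMate, Fin.ext_iff, ne_eq]
  split_ifs <;> omega

section Blocks

variable (n₁ : ℕ) (σ τ : Equiv.Perm (Fin (n₁ + 2)))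

theorem extremalGraph_adj_inl_inl (i j : Fin n₁) :
    ¬ (extremalGraph n₁ σ τ).Adj (.inl i) (.inl j) := by
  simp [extremalGraph, graphH, graphJoin, graphF, alternatingCycle]

theorem extremalGraph_adj_inl_inr (i : Fin n₁) (j : Fin (n₁ + 2) ⊕ Fin (n₁ + 2)) :
    (extremalGraph n₁ σ τ).Adj (.inl i) (.inr j) := by
  simp [extremalGraph, graphH, graphJoin, graphF, alternatingCycle]

theorem extremalGraph_adj_left (i j : Fin (n₁ + 2)) :
    (extremalGraph n₁ σ τ).Adj (.inr (.inl i)) (.inr (.inl j)) ↔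
      (pairGraph (n₁ + 2)).Adj i j := by
  simp [extremalGraph, graphH, graphJoin, graphF, alternatingCycle]

theorem extremalGraph_adj_right (i j : Fin (n₁ + 2)) :
    (extremalGraph n₁ σ τ).Adj (.inr (.inr i)) (.inr (.inr j)) ↔
      (pairGraph (n₁ + 2)).Adj i j := by
  simp [extremalGraph, graphH, graphJoin, graphF, alternatingCycle]

theorem extremalGraph_adj_left_right (i j : Fin (n₁ + 2)) :
    (extremalGraph n₁ σ τ).Adj (.inr (.inl (σ i))) (.inr (.inr (τ j))) ↔
      i ≠ j ∧ i ≠ j + 1 := by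
  simp [extremalGraph, graphH, graphJoin, graphF, alternatingCycle]
  grind

/-- With `f` arbitrary, one expansion serves the quadratic form, the edge count and the cut size.
The matching sums are not doubled, since summing over all i already meets each matching edge from
both ends. -/
theorem adjSum_extremalGraph (heven : Even (n₁ + 2))
    (f : TripartiteVertex n₁ → TripartiteVertex n₁ → ℝ) (hf : ∀ u v, f u v = f v u) :
    adjSum (extremalGraph n₁ σ τ) f =
      2 * (∑ i, ∑ j, f (.inl i) (.inr (.inl j)) + ∑ i, ∑ j, f (.inl i) (.inr (.inr j)) +
        ∑ i, ∑ j, f (.inr (.inl i)) (.inr (.inr j)) -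
        ∑ i, f (.inr (.inl (σ i))) (.inr (.inr (τ i))) -
        ∑ i, f (.inr (.inl (σ (i + 1)))) (.inr (.inr (τ i)))) +
      ∑ i, f (.inr (.inl i)) (.inr (.inl (pairMate heven i))) +
      ∑ i, f (.inr (.inr i)) (.inr (.inr (pairMate heven i))) := by
  classical
  set G := extremalGraph n₁ σ τ with hG
  have hcross : (∑ i, ∑ j, if G.Adj (.inr (.inl i)) (.inr (.inr j))
        then f (.inr (.inl i)) (.inr (.inr j)) else 0) =
      ∑ i, ∑ j, f (.inr (.inl i)) (.inr (.inr j)) -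
        ∑ i, f (.inr (.inl (σ i))) (.inr (.inr (τ i))) -
        ∑ i, f (.inr (.inl (σ (i + 1)))) (.inr (.inr (τ i))) := by
    have hre : ∀ g : Fin (n₁ + 2) → Fin (n₁ + 2) → ℝ,
        ∑ i, ∑ j, g i j = ∑ j, ∑ i, g (σ i) (τ j) := by
      intro g
      rw [← Equiv.sum_comp σ, Finset.sum_comm, ← Equiv.sum_comp τ]
    rw [hre, hre fun i j => f (.inr (.inl i)) (.inr (.inr j)), ← Finset.sum_sub_distrib,
      ← Finset.sum_sub_distrib]
    refine Finset.sum_congr rfl fun j _ => ?_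
    set g : Fin (n₁ + 2) → ℝ := fun i => f (.inr (.inl (σ i))) (.inr (.inr (τ j))) with hg
    -- The cycle neighbours of τ j are σ j and σ (j + 1). They are distinct because n₁ + 2 ≥ 2, so
    -- nothing is subtracted twice.
    have : ∀ i, (if G.Adj (.inr (.inl (σ i))) (.inr (.inr (τ j))) then g i else 0) =
        g i - (if i = j then g i else 0) - (if i = j + 1 then g i else 0) := by
      intro i
      rw [hG, extremalGraph_adj_left_right]
      by_cases h1 : i = j
      · subst h1; simp
      · by_cases h2 : i = j + 1
        · subst h2; simp
        · simp [h1, h2]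
    rw [Finset.sum_congr rfl fun i _ => this i]
    simp only [Finset.sum_sub_distrib, Finset.sum_ite_eq', Finset.mem_univ, if_true, g]
  have hcross' : (∑ j, ∑ i, if G.Adj (.inr (.inr j)) (.inr (.inl i))
        then f (.inr (.inr j)) (.inr (.inl i)) else 0) =
      ∑ i, ∑ j, if G.Adj (.inr (.inl i)) (.inr (.inr j))
        then f (.inr (.inl i)) (.inr (.inr j)) else 0 := by
    rw [Finset.sum_comm]
    refine Finset.sum_congr rfl fun i _ => Finset.sum_congr rfl fun j _ => ?_
    rw [hf]
    exact if_congr (G.adj_comm _ _) rfl rfl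
  have h1 : ∀ i j, G.Adj (.inl i) (.inl j) ↔ False :=
    fun i j => iff_false_intro (extremalGraph_adj_inl_inl n₁ σ τ i j)
  have h2 : ∀ i j, G.Adj (.inl i) (.inr j) ↔ True :=
    fun i j => iff_true_intro (extremalGraph_adj_inl_inr n₁ σ τ i j)
  have h3 : ∀ i j, G.Adj (.inr j) (.inl i) ↔ True :=
    fun i j => iff_true_intro (extremalGraph_adj_inl_inr n₁ σ τ i j).symm
  have h4 : ∀ i j, G.Adj (.inr (.inl i)) (.inr (.inl j)) ↔ pairMate heven i = j := fun i j =>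
    (extremalGraph_adj_left n₁ σ τ i j).trans (pairGraph_adj_iff heven i j)
  have h5 : ∀ i j, G.Adj (.inr (.inr i)) (.inr (.inr j)) ↔ pairMate heven i = j := fun i j =>
    (extremalGraph_adj_right n₁ σ τ i j).trans (pairGraph_adj_iff heven i j)
  have hs2 : ∑ i, ∑ j, f (.inr (.inl i)) (.inl j) = ∑ i, ∑ j, f (.inl i) (.inr (.inl j)) := by
    rw [Finset.sum_comm]
    exact Finset.sum_congr rfl fun i _ => Finset.sum_congr rfl fun j _ => hf _ _
  have hs3 : ∑ i, ∑ j, f (.inr (.inr i)) (.inl j) = ∑ i, ∑ j, f (.inl i) (.inr (.inr j)) := by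
    rw [Finset.sum_comm]
    exact Finset.sum_congr rfl fun i _ => Finset.sum_congr rfl fun j _ => hf _ _
  simp only [adjSum, Fintype.sum_sum_type, Finset.sum_add_distrib]
  rw [hcross', hcross]
  simp only [h1, h2, h3, h4, h5, if_true, if_false, Finset.sum_ite_eq, Finset.mem_univ,
    Finset.sum_const_zero, hs2, hs3]
  ring

end Blocks

/-! ### The lower bound for the form of G. -/

theorem sum_sum_add_sq {ι κ : Type*} [Fintype ι] [Fintype κ] (a : ι → ℝ) (b : κ → ℝ) :
    ∑ i, ∑ j, (a i + b j) ^ 2 = Fintype.card κ * ∑ i, a i ^ 2 + Fintype.card ι * ∑ j, b j ^ 2 +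
      2 * ((∑ i, a i) * ∑ j, b j) := by
  simp only [add_sq, Finset.sum_add_distrib, ← Finset.mul_sum, ← Finset.sum_mul, Finset.sum_const,
    Finset.card_univ, nsmul_eq_mul, mul_assoc]
  ring

/-- Cauchy–Schwarz for the terms b i + b (e i), whose total is twice the sum of b. -/
theorem four_mul_sq_sum_le_of_involutive {N : ℕ} (e : Fin N → Fin N)
    (he : Function.Involutive e) (b : Fin N → ℝ) :
    4 * (∑ i, b i) ^ 2 ≤ N * ∑ i, (b i + b (e i)) ^ 2 := by
  have h := sq_sum_le_card_mul_sum_sq (s := Finset.univ) (f := fun i => b i + b (e i))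
  have h' : ∑ i, b (e i) = ∑ i, b i := Equiv.sum_comp he.toPerm b
  rw [Finset.sum_add_distrib, h', Finset.card_univ, Fintype.card_fin] at h
  linarith

theorem adjSum_extremalGraph_ge (n₁ : ℕ) (hn₁ : 4 ≤ n₁) (heven : Even n₁)
    (σ τ : Equiv.Perm (Fin (n₁ + 2))) (x : TripartiteVertex n₁ → ℝ) :
    2 * ((n₁ : ℝ) + 2) * ∑ v, x v ^ 2 ≤
      adjSum (extremalGraph n₁ σ τ) fun u v => (x u + x v) ^ 2 := by
  have heven' : Even (n₁ + 2) := heven.add even_two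
  rw [adjSum_extremalGraph n₁ σ τ heven' _ fun u v => by ring]
  set a : Fin n₁ → ℝ := fun i => x (.inl i) with ha
  set b : Fin (n₁ + 2) → ℝ := fun i => x (.inr (.inl i)) with hb
  set c : Fin (n₁ + 2) → ℝ := fun i => x (.inr (.inr i)) with hc
  have hN : ((n₁ + 2 : ℕ) : ℝ) = n₁ + 2 := by push_cast; ring
  have hn : (4 : ℝ) ≤ n₁ := by exact_mod_cast hn₁
  have e1 := sum_sum_add_sq a b
  have e2 := sum_sum_add_sq a c
  have e3 := sum_sum_add_sq b c
  simp only [Fintype.card_fin, hN] at e1 e2 e3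
  have m1 := four_mul_sq_sum_le_of_involutive _ (pairMate_pairMate heven') b
  have m2 := four_mul_sq_sum_le_of_involutive _ (pairMate_pairMate heven') c
  have q1 := sq_sum_le_card_mul_sum_sq (s := Finset.univ) (f := a)
  have q2 := sq_sum_le_card_mul_sum_sq (s := Finset.univ) (f := b)
  have q3 := sq_sum_le_card_mul_sum_sq (s := Finset.univ) (f := c)
  simp only [Finset.card_univ, Fintype.card_fin, hN] at m1 m2 q1 q2 q3
  have hσ : ∀ g : Fin (n₁ + 2) → ℝ, ∑ i, g (σ i) = ∑ i, g i := Equiv.sum_comp σ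
  have hτ : ∀ g : Fin (n₁ + 2) → ℝ, ∑ i, g (τ i) = ∑ i, g i := Equiv.sum_comp τ
  have hσ' : ∀ g : Fin (n₁ + 2) → ℝ, ∑ i, g (σ (i + 1)) = ∑ i, g i :=
    fun g => (Equiv.sum_comp (Equiv.addRight (1 : Fin (n₁ + 2))) fun i => g (σ i)).trans (hσ g)
  -- The cycle is a union of two perfect matchings between S₂ and S₃, given by ρ = σ and by its
  -- shift. For each, Cauchy–Schwarz is applied to the differences, and (b + c)² = 2b² + 2c² - (b -
  -- c)² turns it into a bound on the deleted terms.
  have hsq : ∀ ρ : Fin (n₁ + 2) → Fin (n₁ + 2),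
      (∀ g : Fin (n₁ + 2) → ℝ, ∑ i, g (ρ i) = ∑ i, g i) →
      (∑ i, b i - ∑ i, c i) ^ 2 ≤ ((n₁ : ℝ) + 2) * (2 * ∑ i, b i ^ 2 + 2 * ∑ i, c i ^ 2 -
        ∑ i, (b (ρ i) + c (τ i)) ^ 2) := by
    intro ρ hρ
    have h := sq_sum_le_card_mul_sum_sq (s := Finset.univ) (f := fun i => b (ρ i) - c (τ i))
    rw [Finset.sum_sub_distrib, hρ b, hτ c, Finset.card_univ, Fintype.card_fin, hN] at h
    have h' : ∑ i, (b (ρ i) - c (τ i)) ^ 2 = 2 * ∑ i, b i ^ 2 + 2 * ∑ i, c i ^ 2 -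
        ∑ i, (b (ρ i) + c (τ i)) ^ 2 := by
      rw [← hρ fun i => b i ^ 2, ← hτ fun i => c i ^ 2, Finset.mul_sum, Finset.mul_sum,
        ← Finset.sum_add_distrib, ← Finset.sum_sub_distrib]
      exact Finset.sum_congr rfl fun i _ => by ring
    rwa [h'] at h
  have c1 := hsq σ hσ
  have c2 := hsq (fun i => σ (i + 1)) hσ'
  rw [show ∑ v, x v ^ 2 = ∑ i, a i ^ 2 + (∑ i, b i ^ 2 + ∑ i, c i ^ 2) by
    simp only [Fintype.sum_sum_type, a, b, c]]
  rw [e1, e2, e3]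
  generalize ∑ i, (b (σ i) + c (τ i)) ^ 2 = C1 at *
  generalize ∑ i, (b (σ (i + 1)) + c (τ i)) ^ 2 = C2 at *
  generalize ∑ i, (b i + b (pairMate heven' i)) ^ 2 = M1 at *
  generalize ∑ i, (c i + c (pairMate heven' i)) ^ 2 = M2 at *
  generalize ∑ i, a i ^ 2 = a2 at *
  generalize ∑ i, b i ^ 2 = b2 at *
  generalize ∑ i, c i ^ 2 = c2' at *
  generalize ∑ i, a i = A at *
  generalize ∑ i, b i = B at *
  generalize ∑ i, c i = C at *
  generalize (n₁ : ℝ) = n at *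
  -- Multiplying by n(n+2) clears the denominators of all the Cauchy–Schwarz bounds. The cycle
  -- bounds cost 8(b2 + c2'), leaving b2 and c2' with coefficient 2(n - 4), which is where n₁ ≥ 4
  -- enters; what remains is twice the square in `k8`.
  have hpos : 0 < n * (n + 2) := by positivity
  refine le_of_mul_le_mul_left ?_ hpos
  have k1 := mul_le_mul_of_nonneg_left m1 (by linarith : 0 ≤ n)
  have k2 := mul_le_mul_of_nonneg_left m2 (by linarith : 0 ≤ n)
  have k3 := mul_le_mul_of_nonneg_left q1 (by positivity : 0 ≤ 2 * (n + 2) ^ 2)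
  have k4 := mul_le_mul_of_nonneg_left q2 (mul_nonneg (by linarith) (by linarith) :
    0 ≤ 2 * n * (n - 4))
  have k5 := mul_le_mul_of_nonneg_left q3 (mul_nonneg (by linarith) (by linarith) :
    0 ≤ 2 * n * (n - 4))
  have k6 := mul_le_mul_of_nonneg_left c1 (by linarith : 0 ≤ 2 * n)
  have k7 := mul_le_mul_of_nonneg_left c2 (by linarith : 0 ≤ 2 * n)
  have k8 := sq_nonneg ((n + 2) * A + n * (B + C))
  linarith

/-! ### The eigenvalue, the edge count and an optimal cut. -/

theorem smallestQEigenvalue_extremalGraph (n₁ : ℕ) (hn₁ : 4 ≤ n₁) (heven : Even n₁)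
    (σ τ : Equiv.Perm (Fin (n₁ + 2))) :
    smallestQEigenvalue (extremalGraph n₁ σ τ) = (n₁ : ℝ) + 2 := by
  -- On this vector all S₂–S₃ terms vanish, deleted or not; edges at S₁ contribute 1 and matching
  -- edges 4.
  refine smallestQEigenvalue_eq _ _ (adjSum_extremalGraph_ge n₁ hn₁ heven σ τ)
    (Sum.elim (fun _ => 0) (Sum.elim (fun _ => 1) fun _ => -1)) ?_ ?_
  · intro h
    have := congrFun h (.inr (.inl 0))
    simp at this
  · rw [adjSum_extremalGraph n₁ σ τ (heven.add even_two) _ fun u v => by ring]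
    simp [Fintype.sum_sum_type]
    ring

theorem ncard_edgeSet_extremalGraph (n₁ : ℕ) (heven : Even n₁)
    (σ τ : Equiv.Perm (Fin (n₁ + 2))) :
    ((extremalGraph n₁ σ τ).edgeSet.ncard : ℝ) = ((n₁ : ℝ) + 2) * (3 * n₁ + 1) := by
  have h := adjSum_one (extremalGraph n₁ σ τ)
  rw [adjSum_extremalGraph n₁ σ τ (heven.add even_two) _ fun u v => rfl] at h
  simp at h
  linarith

/-- The part of a vertex in the partition into `S₁`, `S₂`, `S₃`. -/
def tripartiteColor {n₁ : ℕ} : TripartiteVertex n₁ → Fin 3 :=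
  Sum.elim (fun _ => 0) (Sum.elim (fun _ => 1) fun _ => 2)

theorem exists_tripartite_subgraph (n₁ : ℕ) (heven : Even n₁)
    (σ τ : Equiv.Perm (Fin (n₁ + 2))) :
    ∃ B ≤ extremalGraph n₁ σ τ, B.Colorable 3 ∧
      (B.edgeSet.ncard : ℝ) = 3 * n₁ * ((n₁ : ℝ) + 2) := by
  classical
  set B := extremalGraph n₁ σ τ ⊓ (⊤ : SimpleGraph (Fin 3)).comap tripartiteColor with hB
  refine ⟨B, inf_le_left, ⟨⟨tripartiteColor, fun h => h.2⟩⟩, ?_⟩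
  -- Counting the cut as an indicator sum over G lets `adjSum_extremalGraph` evaluate it: the
  -- matchings drop out and 2n₁(n₁+2) + (n₁+2)² - 2(n₁+2) edges remain.
  have h1 : adjSum B (fun _ _ => 1) = adjSum (extremalGraph n₁ σ τ)
      (fun u v => if tripartiteColor u = tripartiteColor v then 0 else 1) := by
    refine Finset.sum_congr rfl fun u _ => Finset.sum_congr rfl fun v _ => ?_
    simp only [hB, SimpleGraph.inf_adj, SimpleGraph.comap_adj, SimpleGraph.top_adj]
    split_ifs <;> simp_all
  rw [adjSum_one, adjSum_extremalGraph n₁ σ τ (heven.add even_two) _ fun u v => by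
    simp only [eq_comm]] at h1
  simp [tripartiteColor] at h1
  linarith

theorem proposition5p4 (n₁ : ℕ) (hn₁ : 4 ≤ n₁) (heven : Even n₁)
    (σ τ : Equiv.Perm (Fin (n₁ + 2))) (n m : ℕ) (hn : n = 3 * n₁ + 4)
    (hm : m = (extremalGraph n₁ σ τ).edgeSet.ncard) :
    smallestQEigenvalue (extremalGraph n₁ σ τ) = (n₁ : ℝ) + 2 ∧
      (maxKCut 3 (extremalGraph n₁ σ τ) : ℝ) =
        (((3 : ℝ) - 1) / 3) *
          (2 * (m : ℝ) - (n : ℝ) * smallestQEigenvalue (extremalGraph n₁ σ τ) / 2) := by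
  have hq := smallestQEigenvalue_extremalGraph n₁ hn₁ heven σ τ
  refine ⟨hq, ?_⟩
  have hedge := ncard_edgeSet_extremalGraph n₁ heven σ τ
  obtain ⟨B, hBG, hB3, hBcard⟩ := exists_tripartite_subgraph n₁ heven σ τ
  have hgreatest : IsGreatest {c : ℕ | ∃ B : SimpleGraph (TripartiteVertex n₁),
      B ≤ extremalGraph n₁ σ τ ∧ B.Colorable 3 ∧ B.edgeSet.ncard = c} B.edgeSet.ncard := by
    refine ⟨⟨B, hBG, hB3, rfl⟩, ?_⟩
    rintro _ ⟨B', hB', hc, rfl⟩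
    have h := ncard_edgeSet_le_of_colorable _ _ (adjSum_extremalGraph_ge n₁ hn₁ heven σ τ) 3
      (by norm_num) B' hB' hc
    rw [hedge] at h
    simp only [Fintype.card_sum, Fintype.card_fin] at h
    have h' : (B'.edgeSet.ncard : ℝ) ≤ B.edgeSet.ncard := by
      rw [hBcard]
      push_cast at h
      linarith
    exact_mod_cast h'
  rw [maxKCut, hgreatest.csSup_eq, hBcard, hq, hm, hedge, hn]
  push_cast
  ring
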